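/- Let $\mathcal B=\{1+\sum_{n\ge 1}a_nx^n : a_n\in\{-1,0,1\}\}$, a family of power series converging in the open unit disc $\mathbb D\subset\mathbb C$, and put $$\mathcal M=\{z\in\mathbb D:\ \exists f\in\mathcal B,\ f(z)=0\},\qquad \mathcal N=\{(\gamma,\lambda)\in(-1,1)^2:\ \exists f\in\mathcal B,\ f(\gamma)=f(\lambda)=0\},$$ $$\mathcal O=\{\lambda\in(-1,1):\ \exists f\in\mathcal B,\ f(\lambda)=f'(\lambda)=0\},\qquad \Omega_2=\{x\in(0,1):\ \exists f\in\mathcal B,\ f(x)=f'(x)=0\}.$$ Call $\mathcal M_t=\{z\in\mathbb D: |z|\ge 2^{-1/2}\}$, $\mathcal N_t=\{(\gamma,\lambda)\in(-1,1)^2: |\gamma\lambda|\ge 1/2\}$ and $\mathcal O_t=\{\lambda\in(-1,1): |\lambda|\ge 2^{-1/2}\}$ the trivial parts of $\mathcal M$, $\mathcal N$, $\mathcal O$. **Theorem.** Let $\eta=4\times10^{-6}$. Then 1. $\{(\gamma,\lambda)\in(0,1)^2:\ |\gamma-2^{-1/2}|<\eta,\ |\lambda-2^{-1/2}|<\eta\}\subset\mathcal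 N$; 2. $\{\lambda\in\mathbb D:\ |\lambda-2^{-1/2}|<3\eta/4\}\subset\mathcal M$; 3. $\{\lambda\in(0,1):\ |\lambda-2^{-1/2}|<\eta\}\subset\mathcal O$, and this interval is also contained in $\Omega_2$. In particular, $\mathcal N\setminus\mathcal N_t$, $\mathcal M\setminus\mathcal M_t$ and $\mathcal O\setminus\mathcal O_t$ have nonempty interior (in $\mathbb R^2$, $\mathbb C$ and $\mathbb R$ respectively). Moreover $(0,1)\setminus\Omega_2$ is nonempty and $\sup((0,1)\setminus\Omega_2)\le 2^{-1/2}-4\times10^{-6}$. -/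

import Mathlib

open Set

noncomputable section

/-- The family `ℬ` of power series `1 + ∑_{n ≥ 1} a_n x^n` with `a_n ∈ {-1, 0, 1}`. -/
def seriesB : Set (PowerSeries ℤ) :=
  {f | PowerSeries.coeff 0 f = 1 ∧
    ∀ n : ℕ, 1 ≤ n → PowerSeries.coeff n f ∈ ({-1, 0, 1} : Set ℤ)}

/-- The function `z ↦ ∑_n a_n z^n` on `𝕜 = ℝ` or `ℂ` attached to an integer power series.
For a series in `seriesB` the sum converges absolutely for `‖z‖ < 1`
(`summable_of_mem_seriesB`); it is only used there. -/
def seriesFun (𝕜 : Type*) [RCLike 𝕜] (f : PowerSeries ℤ) (z : 𝕜) : 𝕜 :=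
  ∑' n : ℕ, ((PowerSeries.coeff n f : ℤ) : 𝕜) * z ^ n

theorem summable_of_mem_seriesB {𝕜 : Type*} [RCLike 𝕜] {f : PowerSeries ℤ}
    (hf : f ∈ seriesB) {z : 𝕜} (hz : ‖z‖ < 1) :
    Summable fun n : ℕ => ((PowerSeries.coeff n f : ℤ) : 𝕜) * z ^ n := by
  refine Summable.of_norm_bounded (summable_geometric_of_lt_one (norm_nonneg z) hz) ?_
  intro n
  have h : ‖((PowerSeries.coeff n f : ℤ) : 𝕜)‖ ≤ 1 := by
    rcases Nat.eq_zero_or_pos n with rfl | hn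
    · rw [hf.1]; simp
    · rcases hf.2 n hn with h | h | h <;> rw [h] <;> simp
  rw [norm_mul, norm_pow]
  exact mul_le_of_le_one_left (pow_nonneg (norm_nonneg z) n) h

/-- `Ω₂`: the double zeros in `(0, 1)` of the power series in `ℬ`. -/
def Omega2 : Set ℝ :=
  {x | x ∈ Ioo (0 : ℝ) 1 ∧ ∃ f ∈ seriesB, seriesFun ℝ f x = 0 ∧ deriv (seriesFun ℝ f) x = 0}

/-- The connectedness locus `ℳ`: zeros of the series in `ℬ` in the open complex unit disc. -/
def locusM : Set ℂ :=
  {z | ‖z‖ < 1 ∧ ∃ f ∈ seriesB, seriesFun ℂ f z = 0}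

/-- The connectedness locus `𝒩`: pairs of common real zeros in `(-1, 1)`. -/
def locusN : Set (ℝ × ℝ) :=
  {p | p.1 ∈ Ioo (-1 : ℝ) 1 ∧ p.2 ∈ Ioo (-1 : ℝ) 1 ∧
    ∃ f ∈ seriesB, seriesFun ℝ f p.1 = 0 ∧ seriesFun ℝ f p.2 = 0}

/-- The connectedness locus `𝒪`: double zeros in `(-1, 1)`. -/
def locusO : Set ℝ :=
  {x | x ∈ Ioo (-1 : ℝ) 1 ∧
    ∃ f ∈ seriesB, seriesFun ℝ f x = 0 ∧ deriv (seriesFun ℝ f) x = 0}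

/-- The number `2^{-1/2}`. -/
def invSqrtTwo : ℝ := (2 : ℝ) ^ (-(1 / 2) : ℝ)

/-- The trivial part of `ℳ`. -/
def trivialM : Set ℂ := {z | ‖z‖ < 1 ∧ invSqrtTwo ≤ ‖z‖}

/-- The trivial part of `𝒩`. -/
def trivialN : Set (ℝ × ℝ) :=
  {p | p.1 ∈ Ioo (-1 : ℝ) 1 ∧ p.2 ∈ Ioo (-1 : ℝ) 1 ∧ 1 / 2 ≤ |p.1 * p.2|}

/-- The trivial part of `𝒪`. -/
def trivialO : Set ℝ := {x | x ∈ Ioo (-1 : ℝ) 1 ∧ invSqrtTwo ≤ |x|}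

end

/-! Two points near `2^{-1/2}` (real, conjugate or equal) are the roots of `1 - 2 r z + q z²` with
`r` near `√2` and `q` near `2`. Some `f ∈ ℬ` vanishes at both once `q f` is this quadratic times a
power series with bounded coefficients. Comparing coefficients turns the choice of `f` into a
control problem: choose digits `a ∈ {-1, 0, 1}` so that a planar affine recurrence started at `(0,
q)` stays bounded. The linear part has determinant `q ≈ 2`, and three digits leave enough room for
an invariant region. A union of rectangles serves for all nearby `(r, q)`; its invariance is one
finite integer check (`allCellsViable_eq_true`, `exists_digit_step`), from which
`exists_bounded_quotient` and `seriesFun_eq_quadratic_mul` give the zeros.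

The bound on the supremum also needs `Ω₂` to contain every `x ∈ (2^{-1/2}, 1)`. There a pigeonhole
argument makes `|f(x)| + |x f'(x)|` arbitrarily small on `ℬ`, and compactness of `ℬ` makes it zero
(`mem_Omega2_of_half_lt_sq`). -/

/-! ### The invariant region and its finite verification. -/

/-- Row `i` lists the intervals of cells `(i, j)` that make up a region on which the expanding
map `(x, d) ↦ (d + r x, r d + (r² - q) x + a q)` with digit `a ∈ {-1, 0, 1}` can be kept, for
`r` near `√2` and `q` near `2`. -/
def viableRows : List (List (ℕ × ℕ)) := [
  [(270, 273), (283, 316)],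
  [(253, 272), (283, 313)],
  [(244, 244), (253, 311)],
  [(219, 222), (232, 308)],
  [(202, 221), (232, 304)],
  [(193, 193), (202, 302)],
  [(181, 297)],
  [(181, 294)],
  [(170, 291)],
  [(157, 157), (166, 290)],
  [(148, 157), (160, 285)],
  [(145, 281)],
  [(138, 275)],
  [(130, 270)],
  [(128, 266)],
  [(123, 265)],
  [(118, 259)],
  [(107, 254)],
  [(105, 252)],
  [(100, 241)],
  [(94, 236)],
  [(93, 231)],
  [(89, 229)],
  [(84, 221)],
  [(78, 214)],
  [(74, 199), (202, 211)],
  [(69, 193), (202, 202)],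
  [(68, 189)],
  [(65, 178)],
  [(62, 178)],
  [(57, 157), (166, 166)],
  [(55, 127), (138, 157)],
  [(51, 127), (137, 140)],
  [(48, 106), (115, 115)],
  [(46, 76), (87, 106)],
  [(43, 76), (86, 89)]]

/-- The cells `(i, j)` with `j₀ ≤ j ≤ j₁` lie in one interval of row `i`. -/
def InViableRow (i j₀ j₁ : ℕ) : Bool :=
  (viableRows.getD i []).any fun p => p.1.ble j₀ && j₁.ble p.2

/-- Some digit sends the cell column `j` into the viable part of row `i'`. -/
def digitExists (i' j : ℕ) : Bool :=
  -- Here `t = a + 1`. With `r = 1.4142` and `q = r² = 2` in the map, the new `36 d + 180`, scaled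
  -- by `10000`, is `14142 j + 720000 t - 1465560`; the margin `200` on each side absorbs the errors
  -- in `r` and `q`. The guard keeps the natural subtraction from truncating.
  [0, 1, 2].any fun t => Nat.ble 1465760 (14142 * j + 720000 * t) &&
    InViableRow i' ((14142 * j + 720000 * t - 1465760) / 10000)
      ((14142 * (j + 1) + 720000 * t - 1465360) / 10000)

/-- Every row that the image of the cell `(i, j)` may meet admits a digit. -/
def cellIsViable (i j : ℕ) : Bool :=
  -- The same for the new `3 x + 18`, scaled by `120000`: the exact constant is `2694672`, again
  -- with margin `200`.
  Nat.ble 2694872 (10000 * j + 169704 * i) &&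
    (List.range ((10000 * (j + 1) + 169704 * (i + 1) - 2694472) / 120000 + 1)).all fun i' =>
      Nat.blt i' ((10000 * j + 169704 * i - 2694872) / 120000) || digitExists i' j

def allCellsViable : Bool :=
  (List.range 36).all fun i => (viableRows.getD i []).all fun p =>
    (List.range (p.2 + 1)).all fun j => Nat.blt j p.1 || cellIsViable i j

theorem allCellsViable_eq_true : allCellsViable = true := by decide +kernel

theorem row_lt_of_inViableRow {i j₀ j₁ : ℕ} (h : InViableRow i j₀ j₁ = true) : i < 36 := by
  by_contra hi
  have hrow : viableRows.getD i [] = [] := by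
    rw [List.getD_eq_default]
    simp only [viableRows, List.length_cons, List.length_nil]
    omega
  rw [InViableRow, hrow] at h
  exact Bool.false_ne_true h

theorem cellIsViable_of_inViableRow {i j : ℕ} (h : InViableRow i j j = true) :
    cellIsViable i j = true := by
  have hi := row_lt_of_inViableRow h
  have key := allCellsViable_eq_true
  simp only [allCellsViable, List.all_eq_true, List.mem_range] at key
  simp only [InViableRow, List.any_eq_true, Bool.and_eq_true, Nat.ble_eq] at h
  obtain ⟨p, hp, h1, h2⟩ := h
  have := key i hi p hp j (by omega)
  simp only [Bool.or_eq_true, Nat.blt_eq] at this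
  rcases this with h | h
  · omega
  · exact h

theorem inViableRow_mono {i j₀ j₁ j : ℕ} (h : InViableRow i j₀ j₁ = true) (h₀ : j₀ ≤ j)
    (h₁ : j ≤ j₁) : InViableRow i j j = true := by
  simp only [InViableRow, List.any_eq_true, Bool.and_eq_true, Nat.ble_eq] at h ⊢
  obtain ⟨p, hp, h1, h2⟩ := h
  exact ⟨p, hp, by omega, by omega⟩

/-- The viable region in the coordinates `(x, d)`. -/
def viableRegion : Set (ℝ × ℝ) :=
  -- Cells measure `1/3` by `1/36`. The sign conditions exclude points that `⌊·⌋₊` would send to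
  -- `0`.
  {v | 0 ≤ 3 * v.1 + 18 ∧ 0 ≤ 36 * v.2 + 180 ∧
    InViableRow ⌊3 * v.1 + 18⌋₊ ⌊36 * v.2 + 180⌋₊ ⌊36 * v.2 + 180⌋₊ = true}

theorem inViableRow_bounds {i j : ℕ} (h : InViableRow i j j = true) : i < 36 ∧ j < 360 := by
  have hi := row_lt_of_inViableRow h
  refine ⟨hi, ?_⟩
  have hr : (viableRows.all fun r => r.all fun p => p.2.blt 360) = true := by decide +kernel
  simp only [InViableRow, List.any_eq_true, Bool.and_eq_true, Nat.ble_eq] at h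
  obtain ⟨p, hp, -, h2⟩ := h
  simp only [List.all_eq_true, Nat.blt_eq] at hr
  have hlen : i < viableRows.length := hi
  rw [List.getD_eq_getElem _ _ hlen] at hp
  exact h2.trans_lt (hr _ (List.getElem_mem hlen) p hp)

theorem viableRegion_bounds {v : ℝ × ℝ} (hv : v ∈ viableRegion) :
    |v.1| ≤ 6 ∧ |v.2| ≤ 5 := by
  obtain ⟨h1, h2, h3⟩ := hv
  obtain ⟨hi, hj⟩ := inViableRow_bounds h3
  have hi' := (Nat.floor_lt h1).1 hi
  have hj' := (Nat.floor_lt h2).1 hj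
  push_cast at hi' hj'
  constructor <;> rw [abs_le] <;> constructor <;> linarith

theorem start_mem_viableRegion {q : ℝ} (hq : |q - 2| ≤ 1 / 10 ^ 4) :
    ((0 : ℝ), q) ∈ viableRegion := by
  rw [abs_le] at hq
  have h1 : ⌊(3 * (0 : ℝ) + 18)⌋₊ = 18 := by
    rw [Nat.floor_eq_iff (by norm_num)]; norm_num
  refine ⟨by norm_num, by dsimp only; linarith, ?_⟩
  dsimp only
  rw [h1]
  -- `36 q + 180` is within `0.0036` of `252`, possibly on either side.
  have hr : InViableRow 18 251 252 = true := by decide +kernel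
  refine inViableRow_mono hr ?_ ?_
  · apply Nat.le_floor; push_cast; linarith
  · apply Nat.le_of_lt_succ
    rw [Nat.floor_lt (by linarith)]; push_cast; linarith

/-- From every point of the viable region some digit leads back to the region. -/
theorem exists_digit_step {r q : ℝ} (hr : |r - 1.4142| ≤ 5 / 10 ^ 5) (hq : |q - 2| ≤ 1 / 10 ^ 4)
    (hrq : |r ^ 2 - q| ≤ 1 / 10 ^ 5) {v : ℝ × ℝ} (hv : v ∈ viableRegion) :
    ∃ a : ℤ, a ∈ ({-1, 0, 1} : Set ℤ) ∧
      (v.2 + r * v.1, r * v.2 + (r ^ 2 - q) * v.1 + a * q) ∈ viableRegion := by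
  obtain ⟨hx, hd⟩ := viableRegion_bounds hv
  obtain ⟨h1, h2, h3⟩ := hv
  obtain ⟨x, d⟩ := v
  dsimp only at *
  set i := ⌊3 * x + 18⌋₊ with hi
  set j := ⌊36 * d + 180⌋₊ with hj
  have hi1 : (i : ℝ) ≤ 3 * x + 18 := Nat.floor_le h1
  have hi2 : 3 * x + 18 < i + 1 := Nat.lt_floor_add_one _
  have hj1 : (j : ℝ) ≤ 36 * d + 180 := Nat.floor_le h2
  have hj2 : 36 * d + 180 < j + 1 := Nat.lt_floor_add_one _
  -- Total errors are at most `3 · 3/10⁴ < 200/120000` in the first scaled coordinate and `36 ·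
  -- 41/10⁵ < 200/10000` in the second.
  have hrx : |(r - 1.4142) * x| ≤ 3 / 10 ^ 4 := by
    rw [abs_mul]
    calc _ ≤ (5 / 10 ^ 5) * (6 : ℝ) := by gcongr
      _ = _ := by norm_num
  have hrd : |(r - 1.4142) * d| ≤ 25 / 10 ^ 5 := by
    rw [abs_mul]
    calc _ ≤ (5 / 10 ^ 5) * (5 : ℝ) := by gcongr
      _ = _ := by norm_num
  have hkx : |(r ^ 2 - q) * x| ≤ 6 / 10 ^ 5 := by
    rw [abs_mul]
    calc _ ≤ (1 / 10 ^ 5) * (6 : ℝ) := by gcongr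
      _ = _ := by norm_num
  rw [abs_le] at hrx hrd hkx hq
  have hc := cellIsViable_of_inViableRow h3
  simp only [cellIsViable, Bool.and_eq_true, Nat.ble_eq, List.all_eq_true, List.mem_range,
    Bool.or_eq_true, Nat.blt_eq] at hc
  obtain ⟨hc0, hc⟩ := hc
  have hc0' : (2694872 : ℝ) ≤ 10000 * j + 169704 * i := by exact_mod_cast hc0
  have hu0 : 0 ≤ 3 * (d + r * x) + 18 := by linarith
  have hu1 : (10000 * j + 169704 * i - 2694872) / 120000 ≤ ⌊3 * (d + r * x) + 18⌋₊ := by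
    apply Nat.le_floor
    refine Nat.cast_div_le.trans ?_
    rw [Nat.cast_sub hc0, div_le_iff₀ (by norm_num)]
    push_cast
    linarith
  have hu2 : ⌊3 * (d + r * x) + 18⌋₊ ≤
      (10000 * (j + 1) + 169704 * (i + 1) - 2694472) / 120000 := by
    rw [Nat.le_div_iff_mul_le (by norm_num)]
    apply Nat.le_sub_of_add_le
    have := Nat.floor_le hu0
    have h : (⌊3 * (d + r * x) + 18⌋₊ : ℝ) * 120000 + 2694472 ≤
      10000 * (j + 1) + 169704 * (i + 1) := by linarith
    exact_mod_cast h
  have hdig : digitExists ⌊3 * (d + r * x) + 18⌋₊ j = true := by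
    rcases hc _ (Nat.lt_succ_of_le hu2) with h | h
    · omega
    · exact h
  simp only [digitExists, List.any_eq_true, Bool.and_eq_true, Nat.ble_eq] at hdig
  obtain ⟨t, ht, ht0, hrow⟩ := hdig
  have ht0' : (1465760 : ℝ) ≤ 14142 * j + 720000 * t := by exact_mod_cast ht0
  obtain ⟨a, ha, hat, haq1, haq2⟩ : ∃ a : ℤ, a ∈ ({-1, 0, 1} : Set ℤ) ∧ (t : ℝ) = a + 1 ∧
      2 * (a : ℝ) - 1 / 10 ^ 4 ≤ a * q ∧ a * q ≤ 2 * a + 1 / 10 ^ 4 := by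
    simp only [List.mem_cons, List.not_mem_nil, or_false] at ht
    rcases ht with rfl | rfl | rfl
    · exact ⟨-1, by simp, by norm_num, by push_cast; linarith, by push_cast; linarith⟩
    · exact ⟨0, by simp, by norm_num, by push_cast; linarith, by push_cast; linarith⟩
    · exact ⟨1, by simp, by norm_num, by push_cast; linarith, by push_cast; linarith⟩
  have hw0 : 0 ≤ 36 * (r * d + (r ^ 2 - q) * x + a * q) + 180 := by linarith
  refine ⟨a, ha, hu0, hw0, inViableRow_mono hrow ?_ ?_⟩
  · apply Nat.le_floor
    refine Nat.cast_div_le.trans ?_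
    rw [Nat.cast_sub ht0, div_le_iff₀ (by norm_num)]
    push_cast
    linarith
  · rw [Nat.le_div_iff_mul_le (by norm_num)]
    apply Nat.le_sub_of_add_le
    have := Nat.floor_le hw0
    have h : (⌊36 * (r * d + (r ^ 2 - q) * x + a * q) + 180⌋₊ : ℝ) * 10000 + 1465360 ≤
      14142 * (j + 1) + 720000 * t := by linarith
    exact_mod_cast h

/-! ### From bounded quotients to zeros and double zeros. -/

theorem summable_of_bounded_coeff {𝕜 : Type*} [RCLike 𝕜] {c : ℕ → 𝕜} {C : ℝ}
    (hc : ∀ n, ‖c n‖ ≤ C) {z : 𝕜} (hz : ‖z‖ < 1) : Summable fun n => c n * z ^ n := by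
  refine Summable.of_norm_bounded
    ((summable_geometric_of_lt_one (norm_nonneg z) hz).mul_left C) fun n => ?_
  rw [norm_mul, norm_pow]
  exact mul_le_mul_of_nonneg_right (hc n) (by positivity)

theorem summable_natCast_mul_pow_pred {ρ : ℝ} (h0 : 0 ≤ ρ) (h1 : ρ < 1) :
    Summable fun n : ℕ => (n : ℝ) * ρ ^ (n - 1) := by
  rw [← summable_nat_add_iff 1]
  have hs : Summable fun n : ℕ => (n : ℝ) * ρ ^ n := by
    simpa using summable_pow_mul_geometric_of_norm_lt_one (R := ℝ) 1
      (by rwa [Real.norm_of_nonneg h0] : ‖ρ‖ < 1)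
  refine (hs.add (summable_geometric_of_lt_one h0 h1)).congr fun n => ?_
  push_cast
  ring

theorem hasDerivAt_tsum_mul_pow {c : ℕ → ℝ} {C : ℝ} (hc : ∀ n, |c n| ≤ C) {x : ℝ}
    (hx : |x| < 1) :
    HasDerivAt (fun z => ∑' n, c n * z ^ n) (∑' n, c n * (n * x ^ (n - 1))) x := by
  obtain ⟨ρ, hxρ, hρ⟩ := exists_between hx
  have hρ0 : 0 ≤ ρ := (abs_nonneg x).trans hxρ.le
  refine hasDerivAt_tsum_of_isPreconnected (t := Ioo (-ρ) ρ)
    ((summable_natCast_mul_pow_pred hρ0 hρ).mul_left C) isOpen_Ioo isPreconnected_Ioo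
    (fun n y _ => (hasDerivAt_pow n y).const_mul (c n)) (fun n y hy => ?_)
    (abs_lt.1 hxρ) (summable_of_bounded_coeff hc hx) (abs_lt.1 hxρ)
  have hy' : |y| ≤ ρ := (abs_lt.2 hy).le
  rw [Real.norm_eq_abs, abs_mul, abs_mul, abs_pow, Nat.abs_cast]
  have := (abs_nonneg _).trans (hc n)
  gcongr
  exact hc n

theorem coeff_abs_le_one_of_mem_seriesB {f : PowerSeries ℤ} (hf : f ∈ seriesB) (n : ℕ) :
    |((PowerSeries.coeff n f : ℤ) : ℝ)| ≤ 1 := by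
  rcases Nat.eq_zero_or_pos n with rfl | hn
  · rw [hf.1]; simp
  · rcases hf.2 n hn with h | h | h <;> rw [h] <;> simp

theorem hasDerivAt_seriesFun {f : PowerSeries ℤ} (hf : f ∈ seriesB) {x : ℝ} (hx : |x| < 1) :
    HasDerivAt (seriesFun ℝ f)
      (∑' n : ℕ, ((PowerSeries.coeff n f : ℤ) : ℝ) * (n * x ^ (n - 1))) x :=
  hasDerivAt_tsum_mul_pow (coeff_abs_le_one_of_mem_seriesB hf) hx

/-- There is a digit sequence starting with `1` and with bounded quotient by
`1 - 2 r z + q z²`. -/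
theorem exists_bounded_quotient {r q : ℝ} (hr : |r - 1.4142| ≤ 5 / 10 ^ 5)
    (hq : |q - 2| ≤ 1 / 10 ^ 4) (hrq : |r ^ 2 - q| ≤ 1 / 10 ^ 5) :
    ∃ f ∈ seriesB, ∃ x : ℕ → ℝ, x 0 = 0 ∧ x 1 = q ∧ (∀ n, |x n| ≤ 6) ∧
      ∀ n, q * (PowerSeries.coeff (n + 1) f : ℤ) = x (n + 2) - 2 * r * x (n + 1) + q * x n := by
  choose! digit hdigit hstep using fun (v : ℝ × ℝ) (hv : v ∈ viableRegion) =>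
    exists_digit_step hr hq hrq hv
  -- The second coordinate is `d n = x (n + 1) - r * x n`, which makes the linear part nearly a
  -- Jordan block when `r² ≈ q`.
  let next : ℝ × ℝ → ℝ × ℝ := fun v =>
    (v.2 + r * v.1, r * v.2 + (r ^ 2 - q) * v.1 + digit v * q)
  let state : ℕ → ℝ × ℝ := fun n => next^[n] (0, q)
  have hsucc : ∀ n, state (n + 1) = next (state n) := fun n =>
    Function.iterate_succ_apply' next n _
  have hmem : ∀ n, state n ∈ viableRegion := by
    intro n
    induction n with
    | zero => exact start_mem_viableRegion hq
    | succ n ih => rw [hsucc]; exact hstep _ ih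
  refine ⟨PowerSeries.mk fun n => Nat.casesOn n 1 fun m => digit (state m), ⟨?_, ?_⟩,
    fun n => (state n).1, rfl, ?_, fun n => (viableRegion_bounds (hmem n)).1, fun n => ?_⟩
  · simp
  · rintro (_ | n) hn
    · omega
    · rw [PowerSeries.coeff_mk]
      exact hdigit _ (hmem n)
  · simp [state, next]
  · rw [PowerSeries.coeff_mk]
    simp only [hsucc, next]
    ring

/-- Generating-function form of the recurrence; the bound on `x` gives convergence in the whole unit
disc. -/
theorem seriesFun_eq_quadratic_mul {𝕜 : Type*} [RCLike 𝕜] {f : PowerSeries ℤ}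
    (hf : f ∈ seriesB) {r q : ℝ} {x : ℕ → ℝ} (hx0 : x 0 = 0) (hx1 : x 1 = q)
    (hb : ∀ n, |x n| ≤ 6)
    (hrec : ∀ n, q * (PowerSeries.coeff (n + 1) f : ℤ) =
      x (n + 2) - 2 * r * x (n + 1) + q * x n)
    {z : 𝕜} (hz : ‖z‖ < 1) :
    (q : 𝕜) * seriesFun 𝕜 f z =
      (1 - 2 * r * z + q * z ^ 2) * ∑' n, (x (n + 1) : 𝕜) * z ^ n := by
  have hs : ∀ k, Summable fun n => (x (n + k) : 𝕜) * z ^ n := fun k =>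
    summable_of_bounded_coeff (C := 6) (fun n => by rw [RCLike.norm_ofReal]; exact hb _) hz
  have hs0 : Summable fun n => (x n : 𝕜) * z ^ n := hs 0
  have e0 : ∑' n, (x n : 𝕜) * z ^ n = z * ∑' n, (x (n + 1) : 𝕜) * z ^ n := by
    rw [hs0.tsum_eq_zero_add, ← tsum_mul_left]
    simp only [hx0, RCLike.ofReal_zero, zero_mul, zero_add]
    exact tsum_congr fun n => by ring
  have e1 : ∑' n, (x (n + 1) : 𝕜) * z ^ n = q + z * ∑' n, (x (n + 2) : 𝕜) * z ^ n := by
    rw [(hs 1).tsum_eq_zero_add, ← tsum_mul_left]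
    simp only [hx1, zero_add, pow_zero, mul_one]
    congr 1
    exact tsum_congr fun n => by ring
  have e2 : seriesFun 𝕜 f z =
      1 + z * ∑' n, ((PowerSeries.coeff (n + 1) f : ℤ) : 𝕜) * z ^ n := by
    rw [seriesFun, (summable_of_mem_seriesB hf hz).tsum_eq_zero_add, hf.1, ← tsum_mul_left]
    simp only [Int.cast_one, pow_zero, mul_one]
    congr 1
    exact tsum_congr fun n => by ring
  have e3 : (q : 𝕜) * ∑' n, ((PowerSeries.coeff (n + 1) f : ℤ) : 𝕜) * z ^ n =
      ∑' n, (x (n + 2) : 𝕜) * z ^ n - 2 * r * ∑' n, (x (n + 1) : 𝕜) * z ^ n +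
        q * ∑' n, (x n : 𝕜) * z ^ n := by
    rw [← tsum_mul_left, ← tsum_mul_left, ← tsum_mul_left,
      ← (hs 2).tsum_sub ((hs 1).mul_left _),
      ← ((hs 2).sub ((hs 1).mul_left _)).tsum_add (hs0.mul_left _)]
    refine tsum_congr fun n => ?_
    have := congrArg (fun t : ℝ => (t : 𝕜)) (hrec n)
    push_cast at this
    linear_combination (z ^ n) * this
  rw [e2, mul_add, mul_left_comm, e3, e0]
  linear_combination -e1

/-- The series is chosen before `z`, so it vanishes at both roots of the quadratic at once. -/
theorem exists_seriesB_zero {r q : ℝ} (hr : |r - 1.4142| ≤ 5 / 10 ^ 5)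
    (hq : |q - 2| ≤ 1 / 10 ^ 4) (hrq : |r ^ 2 - q| ≤ 1 / 10 ^ 5) (𝕜 : Type*) [RCLike 𝕜] :
    ∃ f ∈ seriesB, ∀ z : 𝕜, ‖z‖ < 1 → 1 - 2 * r * z + q * z ^ 2 = 0 →
      seriesFun 𝕜 f z = 0 := by
  obtain ⟨f, hf, x, hx0, hx1, hb, hrec⟩ := exists_bounded_quotient hr hq hrq
  refine ⟨f, hf, fun z hz h => ?_⟩
  have := seriesFun_eq_quadratic_mul hf hx0 hx1 hb hrec hz
  rw [h, zero_mul, mul_eq_zero] at this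
  refine this.resolve_left fun hq0 => ?_
  rw [RCLike.ofReal_eq_zero] at hq0
  rw [abs_le] at hq
  linarith

/-- With `r = l⁻¹` and `q = r²` the quadratic is a square, so the product rule kills the derivative
too. -/
theorem exists_seriesB_double_zero {l : ℝ} (h0 : 0 < l) (h1 : l < 1)
    (hr : |l⁻¹ - 1.4142| ≤ 5 / 10 ^ 5) (hq : |l⁻¹ ^ 2 - 2| ≤ 1 / 10 ^ 4) :
    ∃ f ∈ seriesB, seriesFun ℝ f l = 0 ∧ deriv (seriesFun ℝ f) l = 0 := by
  obtain ⟨f, hf, x, hx0, hx1, hb, hrec⟩ := exists_bounded_quotient hr hq (by norm_num)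
  have hl : |l| < 1 := by rwa [abs_of_pos h0]
  have hY := hasDerivAt_tsum_mul_pow (c := fun n => x (n + 1)) (C := 6) (fun n => hb _) hl
  have hfac : ∀ᶠ z in nhds l, seriesFun ℝ f z =
      l ^ 2 * ((1 - l⁻¹ * z) ^ 2 * ∑' n, x (n + 1) * z ^ n) := by
    filter_upwards [(isOpen_Iio.preimage continuous_abs).mem_nhds hl] with z hz
    have := seriesFun_eq_quadratic_mul (𝕜 := ℝ) hf hx0 hx1 hb hrec hz
    simp only [RCLike.ofReal_real_eq_id, id] at this
    have hl2 : l ^ 2 * l⁻¹ ^ 2 = 1 := by field_simp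
    linear_combination l ^ 2 * this - seriesFun ℝ f z * hl2
  have hlin : HasDerivAt (fun z : ℝ => 1 - l⁻¹ * z) (-l⁻¹) l := by
    simpa using ((hasDerivAt_id l).const_mul l⁻¹).const_sub 1
  have hd := (((hlin.pow 2).mul hY).const_mul (l ^ 2)).congr_of_eventuallyEq hfac
  refine ⟨f, hf, ?_, ?_⟩
  · rw [hfac.self_of_nhds, inv_mul_cancel₀ h0.ne']
    simp
  · rw [hd.deriv]
    simp [h0.ne']

/-! ### Double zeros above `2^{-1/2}`, by pigeonhole and compactness. -/

/-- The real coefficient sequences of the series in `seriesB`. -/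
def digitSequences : Set (ℕ → ℝ) :=
  {a | a 0 = 1 ∧ ∀ n, a n ∈ ({-1, 0, 1} : Set ℝ)}

theorem abs_le_one_of_mem_digits {t : ℝ} (ht : t ∈ ({-1, 0, 1} : Set ℝ)) : |t| ≤ 1 := by
  rcases ht with rfl | rfl | rfl <;> simp

theorem mul_mem_digits {s t : ℝ} (hs : s ∈ ({-1, 0, 1} : Set ℝ))
    (ht : t ∈ ({-1, 0, 1} : Set ℝ)) : s * t ∈ ({-1, 0, 1} : Set ℝ) := by
  rcases hs with rfl | rfl | rfl <;> rcases ht with rfl | rfl | rfl <;> simp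

theorem isCompact_digitSequences : IsCompact digitSequences := by
  have h : IsCompact (univ.pi fun _ : ℕ => ({-1, 0, 1} : Set ℝ)) :=
    isCompact_univ_pi fun _ => (toFinite _).isCompact
  have he : digitSequences = (univ.pi fun _ : ℕ => ({-1, 0, 1} : Set ℝ)) ∩ {a | a 0 = 1} := by
    ext a
    simp [digitSequences, and_comm]
  rw [he]
  exact h.inter_right (isClosed_eq (continuous_apply 0) continuous_const)

theorem continuousOn_tsum_digitSequences {w : ℕ → ℝ} (hw : Summable w) (hw0 : ∀ n, 0 ≤ w n) :
    ContinuousOn (fun a : ℕ → ℝ => ∑' n, a n * w n) digitSequences := by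
  refine continuousOn_tsum (fun n => by fun_prop) hw fun n a ha => ?_
  rw [norm_mul, Real.norm_eq_abs, Real.norm_of_nonneg (hw0 n)]
  exact mul_le_of_le_one_left (hw0 n) (abs_le_one_of_mem_digits (ha.2 n))

theorem summable_natCast_mul_pow {x : ℝ} (h0 : 0 ≤ x) (h1 : x < 1) :
    Summable fun n : ℕ => (n : ℝ) * x ^ n := by
  simpa using summable_pow_mul_geometric_of_norm_lt_one (R := ℝ) 1
    (by rwa [Real.norm_of_nonneg h0] : ‖x‖ < 1)

/-- Pigeonhole: two distinct `0/1` combinations of `n` planar vectors nearly coincide. -/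
theorem exists_small_digit_combination {v w : ℕ → ℝ} (hv0 : ∀ n, 0 ≤ v n) (hw0 : ∀ n, 0 ≤ w n)
    {C : ℝ} {n : ℕ} (hv : ∑ m ∈ Finset.range n, v m ≤ C) (hw : ∑ m ∈ Finset.range n, w m ≤ C)
    {ε : ℝ} (hε : 0 < ε) (hcard : (C / ε + 1) ^ 2 < 2 ^ n) :
    ∃ b : ℕ → ℝ, (∀ m, b m ∈ ({-1, 0, 1} : Set ℝ)) ∧ (∃ m, b m ≠ 0) ∧ (∀ m, n ≤ m → b m = 0) ∧
      |∑ m ∈ Finset.range n, b m * v m| ≤ ε ∧ |∑ m ∈ Finset.range n, b m * w m| ≤ ε := by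
  classical
  have hC : 0 ≤ C := (Finset.sum_nonneg fun m _ => hv0 m).trans hv
  -- Subset sums are sorted into boxes of side `ε`. There are `2 ^ n` subsets and fewer boxes, so
  -- two subsets share a box; the difference of their indicators is `b`.
  let F : (ℕ → ℝ) → Finset ℕ → ℕ := fun u s => ⌊(∑ m ∈ s, u m) / ε⌋₊
  have hF : ∀ u : ℕ → ℝ, (∀ m, 0 ≤ u m) → ∑ m ∈ Finset.range n, u m ≤ C →
      ∀ s ∈ (Finset.range n).powerset, F u s ∈ Finset.range (⌊C / ε⌋₊ + 1) := by
    intro u hu0 hu s hs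
    rw [Finset.mem_range, Nat.lt_succ_iff]
    apply Nat.floor_le_floor
    gcongr
    exact (Finset.sum_le_sum_of_subset_of_nonneg (Finset.mem_powerset.1 hs)
      fun m _ _ => hu0 m).trans hu
  obtain ⟨s, hs, t, ht, hst, heq⟩ := Finset.exists_ne_map_eq_of_card_lt_of_maps_to
    (s := (Finset.range n).powerset)
    (t := Finset.range (⌊C / ε⌋₊ + 1) ×ˢ Finset.range (⌊C / ε⌋₊ + 1))
    (f := fun s => (F v s, F w s))
    (by
      rw [Finset.card_product, Finset.card_powerset, Finset.card_range, Finset.card_range]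
      have h : ((⌊C / ε⌋₊ : ℝ) + 1) * (⌊C / ε⌋₊ + 1) < 2 ^ n := by
        refine lt_of_le_of_lt ?_ hcard
        rw [← sq]
        gcongr
        exact Nat.floor_le (by positivity)
      exact_mod_cast h)
    (fun s hs => Finset.mem_coe.2 (Finset.mem_product.2 ⟨hF v hv0 hv s hs, hF w hw0 hw s hs⟩))
  have hs' := Finset.mem_powerset.1 hs
  have ht' := Finset.mem_powerset.1 ht
  have hclose : ∀ u : ℕ → ℝ, (∀ m, 0 ≤ u m) → F u s = F u t →
      |∑ m ∈ Finset.range n, ((if m ∈ s then 1 else 0) - (if m ∈ t then 1 else 0)) * u m|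
        ≤ ε := by
    intro u hu0 hst
    have hsum : ∀ s' ⊆ Finset.range n,
        ∑ m ∈ Finset.range n, (if m ∈ s' then (1 : ℝ) else 0) * u m = ∑ m ∈ s', u m := by
      intro s' hs'
      simp only [ite_mul, one_mul, zero_mul]
      rw [Finset.sum_ite_mem, Finset.inter_eq_right.2 hs']
    simp only [sub_mul]
    rw [Finset.sum_sub_distrib, hsum s hs', hsum t ht']
    have hp : ∀ s' : Finset ℕ, 0 ≤ (∑ m ∈ s', u m) / ε := fun s' =>
      div_nonneg (Finset.sum_nonneg fun m _ => hu0 m) hε.le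
    have h1 := Nat.floor_le (hp s)
    have h2 := Nat.lt_floor_add_one ((∑ m ∈ s, u m) / ε)
    have h3 := Nat.floor_le (hp t)
    have h4 := Nat.lt_floor_add_one ((∑ m ∈ t, u m) / ε)
    simp only [F] at hst
    rw [← hst] at h3 h4
    have h5 : |(∑ m ∈ s, u m) / ε - (∑ m ∈ t, u m) / ε| ≤ 1 := by
      rw [abs_le]; constructor <;> linarith
    rwa [← sub_div, abs_div, abs_of_pos hε, div_le_one hε] at h5
  refine ⟨fun m => (if m ∈ s then 1 else 0) - (if m ∈ t then 1 else 0), fun m => ?_, ?_, ?_,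
    hclose v hv0 (congrArg Prod.fst heq), hclose w hw0 (congrArg Prod.snd heq)⟩
  · dsimp only
    split_ifs <;> simp
  · by_contra! h
    refine hst (Finset.ext fun m => ?_)
    have := h m
    split_ifs at this with h1 h2 h2 <;> simp_all
  · intro m hm
    have h1 : m ∉ s := fun h => by have := Finset.mem_range.1 (hs' h); omega
    have h2 : m ∉ t := fun h => by have := Finset.mem_range.1 (ht' h); omega
    simp [h1, h2]

/-- For `2^{-1/2} < ρ < x`, pigeonhole at scale `ρ ^ n` applies because `2 ρ² > 1`. Removing the
leading zeros divides by `x ^ k` with `k ≤ n`, leaving sums of size `(ρ / x) ^ n`; the shift of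
index adds `k * A` to the second sum, whence the factor `n + 2`. -/
theorem exists_digitSequence_small {x : ℝ} (h0 : 0 < x) (h1 : x < 1) (hx : 1 / 2 < x ^ 2)
    {δ : ℝ} (hδ : 0 < δ) :
    ∃ a ∈ digitSequences, |∑' n, a n * x ^ n| + |∑' n, a n * (n * x ^ n)| < δ := by
  obtain ⟨ρ, hρ0, hρ1, hρ2⟩ : ∃ ρ : ℝ, 0 < ρ ∧ ρ < x ∧ 1 < 2 * ρ ^ 2 := by
    obtain ⟨σ, hσ1, hσ2⟩ := exists_between hx
    have hσ : 0 < σ := by linarith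
    refine ⟨√σ, Real.sqrt_pos.2 hσ, (Real.sqrt_lt' h0).2 hσ2, ?_⟩
    rw [Real.sq_sqrt hσ.le]
    linarith
  have hs1 := summable_geometric_of_lt_one h0.le h1
  have hs2 := summable_natCast_mul_pow h0.le h1
  obtain ⟨C, hC0, hC1, hC2⟩ : ∃ C : ℝ, 0 ≤ C ∧ ∑' n : ℕ, x ^ n ≤ C ∧
      ∑' n : ℕ, (n : ℝ) * x ^ n ≤ C :=
    ⟨max (∑' n : ℕ, x ^ n) (∑' n : ℕ, (n : ℝ) * x ^ n),
      le_max_of_le_left (tsum_nonneg fun n => by positivity), le_max_left _ _, le_max_right _ _⟩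
  have hlim : Filter.Tendsto (fun n : ℕ => ((n : ℝ) + 2) * (ρ / x) ^ n) Filter.atTop
      (nhds 0) := by
    have hq0 : 0 ≤ ρ / x := by positivity
    have hq1 : ρ / x < 1 := (div_lt_one h0).2 hρ1
    have := ((summable_natCast_mul_pow hq0 hq1).tendsto_atTop_zero).add
      ((tendsto_pow_atTop_nhds_zero_of_lt_one hq0 hq1).const_mul 2)
    simp only [mul_zero, add_zero] at this
    exact this.congr fun n => by ring
  obtain ⟨n, hn1, hn2⟩ := ((hlim.eventually (gt_mem_nhds hδ)).and
    ((tendsto_pow_atTop_atTop_of_one_lt hρ2).eventually_gt_atTop ((C + 1) ^ 2))).exists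
  have hcard : (C / ρ ^ n + 1) ^ 2 < 2 ^ n := by
    have hρn : ρ ^ n ≤ 1 := pow_le_one₀ hρ0.le (by linarith)
    have hpos : 0 < ρ ^ n := by positivity
    calc (C / ρ ^ n + 1) ^ 2 ≤ ((C + 1) / ρ ^ n) ^ 2 := by
          have : 1 ≤ 1 / ρ ^ n := (one_le_div hpos).2 hρn
          have : C / ρ ^ n + 1 ≤ (C + 1) / ρ ^ n := by rw [add_div]; linarith
          gcongr
      _ < 2 ^ n := by
          rw [div_pow, div_lt_iff₀ (by positivity)]
          calc _ < (2 * ρ ^ 2) ^ n := hn2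
            _ = _ := by rw [mul_pow]; ring
  obtain ⟨b, hb, hne, hbn, hv, hw⟩ := exists_small_digit_combination
    (v := fun m => x ^ m) (w := fun m => (m : ℝ) * x ^ m) (fun m => by positivity)
    (fun m => by positivity)
    ((hs1.sum_le_tsum _ fun m _ => by positivity).trans hC1)
    ((hs2.sum_le_tsum _ fun m _ => by positivity).trans hC2)
    (show 0 < ρ ^ n by positivity) hcard
  classical
  set k := Nat.find hne with hk
  have hbk : b k ≠ 0 := Nat.find_spec hne
  have hlt : ∀ m < k, b m = 0 := fun m hm => not_not.1 (Nat.find_min hne hm)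
  have hkn : k ≤ n := by
    by_contra h
    exact hbk (hbn k (by omega))
  have hbk1 : b k * b k = 1 := by
    rcases hb k with h | h | h
    · rw [h]; norm_num
    · exact absurd h hbk
    · rw [mem_singleton_iff.1 h]; norm_num
  have hbk2 : |b k| = 1 := by
    rcases hb k with h | h | h
    · rw [h]; norm_num
    · exact absurd h hbk
    · rw [mem_singleton_iff.1 h]; norm_num
  have hsum : ∀ u : ℕ → ℝ, ∑ m ∈ Finset.range n, b m * u m = ∑' m, b (m + k) * u (m + k) := by
    intro u
    have hz : ∀ m, m ∉ Finset.range n → b m * u m = 0 := fun m hm => by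
      rw [hbn m (by simpa using hm), zero_mul]
    rw [← tsum_eq_sum (L := .unconditional ℕ) hz, ← (summable_of_ne_finset_zero hz).sum_add_tsum_nat_add k,
      Finset.sum_eq_zero, zero_add]
    intro m hm
    rw [hlt m (Finset.mem_range.1 hm), zero_mul]
  have ha1 : ∀ m, |b (m + k)| ≤ 1 := fun m => abs_le_one_of_mem_digits (hb _)
  have hsA : Summable fun m => b (m + k) * x ^ m :=
    summable_of_bounded_coeff (C := 1) ha1 (by rwa [Real.norm_of_nonneg h0.le])
  have hsB : Summable fun m => b (m + k) * (m * x ^ m) := by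
    refine Summable.of_norm_bounded hs2 fun m => ?_
    rw [norm_mul, Real.norm_eq_abs, Real.norm_of_nonneg (by positivity : (0 : ℝ) ≤ m * x ^ m)]
    exact mul_le_of_le_one_left (by positivity) (ha1 m)
  set A := ∑' m, b (m + k) * x ^ m with hA
  set B := ∑' m, b (m + k) * (m * x ^ m) with hB
  rw [hsum] at hv hw
  have hvA : ∑' m, b (m + k) * x ^ (m + k) = x ^ k * A := by
    rw [hA, ← tsum_mul_left]
    exact tsum_congr fun m => by ring
  have hwB : ∑' m, b (m + k) * (((m + k : ℕ) : ℝ) * x ^ (m + k)) = x ^ k * (B + k * A) := by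
    rw [hA, hB, ← tsum_mul_left (a := (k : ℝ)), ← hsB.tsum_add (hsA.mul_left _), ← tsum_mul_left]
    exact tsum_congr fun m => by push_cast; ring
  rw [hvA, abs_mul, abs_of_pos (by positivity : 0 < x ^ k)] at hv
  rw [hwB, abs_mul, abs_of_pos (by positivity : 0 < x ^ k)] at hw
  have hdiv : ∀ y : ℝ, 0 ≤ y → x ^ k * y ≤ ρ ^ n → y ≤ (ρ / x) ^ n := by
    intro y hy h
    rw [div_pow, le_div_iff₀ (by positivity)]
    calc y * x ^ n ≤ y * x ^ k :=
          mul_le_mul_of_nonneg_left (pow_le_pow_of_le_one h0.le h1.le hkn) hy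
      _ ≤ ρ ^ n := by linarith
  have hAle := hdiv _ (abs_nonneg _) hv
  have hBle := hdiv _ (abs_nonneg _) hw
  -- Multiplying by the sign `b k` makes the constant term `1`.
  refine ⟨fun m => b k * b (m + k), ⟨by simpa using hbk1, fun m => ?_⟩, ?_⟩
  · exact mul_mem_digits (hb k) (hb _)
  · simp only [mul_assoc]
    rw [tsum_mul_left, tsum_mul_left, abs_mul, abs_mul, hbk2, one_mul, one_mul, ← hA, ← hB]
    refine lt_of_le_of_lt ?_ hn1
    have hkA : |k * A| ≤ n * (ρ / x) ^ n := by
      rw [abs_mul, Nat.abs_cast]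
      gcongr
    have htri : |B| ≤ |B + k * A| + |k * A| := by
      have := abs_sub (B + k * A) (k * A)
      rwa [add_sub_cancel_right] at this
    linarith

/-- The minimum over the compact set of digit sequences is attained and cannot be positive. The
second sum is `x f'(x)`, which is why a factor `x` is cancelled at the end. -/
theorem mem_Omega2_of_half_lt_sq {x : ℝ} (h0 : 0 < x) (h1 : x < 1) (hx : 1 / 2 < x ^ 2) :
    x ∈ Omega2 := by
  have hs1 := summable_geometric_of_lt_one h0.le h1
  have hs2 := summable_natCast_mul_pow h0.le h1
  have hcont : ContinuousOn (fun a : ℕ → ℝ => |∑' n, a n * x ^ n| + |∑' n, a n * (n * x ^ n)|)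
      digitSequences :=
    (continuousOn_tsum_digitSequences hs1 fun n => by positivity).abs.add
      (continuousOn_tsum_digitSequences hs2 fun n => by positivity).abs
  obtain ⟨a₀, ha₀, -⟩ := exists_digitSequence_small h0 h1 hx one_pos
  obtain ⟨a, ha, hmin⟩ := isCompact_digitSequences.exists_isMinOn ⟨a₀, ha₀⟩ hcont
  have hzero : |∑' n, a n * x ^ n| + |∑' n, a n * (n * x ^ n)| = 0 := by
    by_contra hne
    obtain ⟨a', ha', hlt⟩ := exists_digitSequence_small h0 h1 hx
      (lt_of_le_of_ne (by positivity) (Ne.symm hne))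
    exact absurd (hmin ha') (not_le.2 hlt)
  have hz1 : ∑' n, a n * x ^ n = 0 := abs_eq_zero.1 (by
    linarith [abs_nonneg (∑' n, a n * x ^ n), abs_nonneg (∑' n, a n * (n * x ^ n))])
  have hz2 : ∑' n, a n * (n * x ^ n) = 0 := abs_eq_zero.1 (by
    linarith [abs_nonneg (∑' n, a n * x ^ n), abs_nonneg (∑' n, a n * (n * x ^ n))])
  have hint : ∀ n, ∃ c : ℤ, c ∈ ({-1, 0, 1} : Set ℤ) ∧ (c : ℝ) = a n := by
    intro n
    rcases ha.2 n with h | h | h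
    · exact ⟨-1, by simp, by rw [h]; simp⟩
    · exact ⟨0, by simp, by rw [h]; simp⟩
    · exact ⟨1, by simp, by rw [mem_singleton_iff.1 h]; simp⟩
  choose c hc hca using hint
  have hf : PowerSeries.mk c ∈ seriesB := by
    refine ⟨?_, fun n _ => ?_⟩
    · rw [PowerSeries.coeff_mk]
      have := hca 0
      rw [ha.1] at this
      exact_mod_cast this
    · rw [PowerSeries.coeff_mk]
      exact hc n
  refine ⟨⟨h0, h1⟩, PowerSeries.mk c, hf, ?_, ?_⟩
  · simpa [seriesFun, hca] using hz1
  · rw [(hasDerivAt_seriesFun hf (by rwa [abs_of_pos h0])).deriv]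
    simp only [PowerSeries.coeff_mk, hca]
    refine (mul_eq_zero.1 (?_ : x * _ = 0)).resolve_left h0.ne'
    rw [← tsum_mul_left, ← hz2]
    refine tsum_congr fun n => ?_
    rcases n with _ | n
    · simp
    · rw [Nat.add_sub_cancel]
      ring

/-! ### Numerical estimates near `2^{-1/2}` and the conclusions. -/

theorem invSqrtTwo_pos : 0 < invSqrtTwo := Real.rpow_pos_of_pos two_pos _

theorem invSqrtTwo_sq : invSqrtTwo ^ 2 = 1 / 2 := by
  rw [invSqrtTwo, ← Real.rpow_natCast, ← Real.rpow_mul two_pos.le]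
  norm_num [Real.rpow_neg_one]

theorem invSqrtTwo_bounds : 0.70710678 < invSqrtTwo ∧ invSqrtTwo < 0.70710679 := by
  have h0 := invSqrtTwo_pos
  have h2 := invSqrtTwo_sq
  constructor
  · exact lt_of_pow_lt_pow_left₀ 2 h0.le (by rw [h2]; norm_num)
  · exact lt_of_pow_lt_pow_left₀ 2 (by norm_num) (by rw [h2]; norm_num)

theorem inv_bounds_of_near {t : ℝ} (ht : |t - invSqrtTwo| < 4 / 10 ^ 6) :
    0 < t ∧ t < 1 ∧ 1.4142 ≤ t⁻¹ ∧ t⁻¹ ≤ 1.41423 := by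
  obtain ⟨h1, h2⟩ := invSqrtTwo_bounds
  rw [abs_lt] at ht
  have h0 : 0 < t := by linarith
  refine ⟨h0, by linarith, ?_, ?_⟩
  · rw [le_inv_comm₀ (by norm_num) h0]
    norm_num
    linarith
  · rw [inv_le_comm₀ h0 (by norm_num)]
    norm_num
    linarith

theorem mem_locusN_of_near {g l : ℝ} (hg : |g - invSqrtTwo| < 4 / 10 ^ 6)
    (hl : |l - invSqrtTwo| < 4 / 10 ^ 6) : (g, l) ∈ locusN := by
  obtain ⟨g0, g1, hg1, hg2⟩ := inv_bounds_of_near hg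
  obtain ⟨l0, l1, hl1, hl2⟩ := inv_bounds_of_near hl
  obtain ⟨f, hf, h⟩ := exists_seriesB_zero (r := (g⁻¹ + l⁻¹) / 2) (q := g⁻¹ * l⁻¹)
    (by rw [abs_le]; constructor <;> linarith)
    (by rw [abs_le]; constructor <;> nlinarith)
    (by
      -- `r² - q` is a quarter of the discriminant in the inverse roots, hence quadratically small.
      have : ((g⁻¹ + l⁻¹) / 2) ^ 2 - g⁻¹ * l⁻¹ = ((g⁻¹ - l⁻¹) / 2) ^ 2 := by ring
      rw [this, abs_of_nonneg (sq_nonneg _)]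
      calc ((g⁻¹ - l⁻¹) / 2) ^ 2 ≤ (3 / 10 ^ 5) ^ 2 :=
            sq_le_sq' (by linarith) (by linarith)
        _ ≤ _ := by norm_num) ℝ
  refine ⟨⟨by linarith, g1⟩, ⟨by linarith, l1⟩, f, hf, h g ?_ ?_, h l ?_ ?_⟩
  · rwa [Real.norm_of_nonneg g0.le]
  · simp only [RCLike.ofReal_real_eq_id, id]
    field_simp
    ring
  · rwa [Real.norm_of_nonneg l0.le]
  · simp only [RCLike.ofReal_real_eq_id, id]
    field_simp
    ring

/-- The roots are `z` and its conjugate, so `r = Re z / |z|²`, `q = 1 / |z|²`, and `r² - q = -(Im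
z)² / |z|⁴` is again quadratically small. -/
theorem mem_locusM_of_near {z : ℂ} (hz : ‖z - (invSqrtTwo : ℂ)‖ < 3 / 10 ^ 6) :
    z ∈ locusM := by
  obtain ⟨h1, h2⟩ := invSqrtTwo_bounds
  have hre := abs_lt.1 ((Complex.abs_re_le_norm _).trans_lt hz)
  have him := abs_lt.1 ((Complex.abs_im_le_norm _).trans_lt hz)
  simp only [Complex.sub_re, Complex.sub_im, Complex.ofReal_re, Complex.ofReal_im,
    sub_zero] at hre him
  have hnorm : ‖z‖ < 1 := by
    have := norm_le_norm_add_norm_sub' z (invSqrtTwo : ℂ)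
    rw [Complex.norm_real, Real.norm_of_nonneg invSqrtTwo_pos.le] at this
    linarith
  set a := z.re with ha
  set N := Complex.normSq z with hN
  have hNz : N = a ^ 2 + z.im ^ 2 := by rw [hN, Complex.normSq_apply]; ring
  have him2 : z.im ^ 2 ≤ (3 / 10 ^ 6) ^ 2 := sq_le_sq' (by linarith) (by linarith)
  have ha1 : (0.7071037 : ℝ) ^ 2 ≤ a ^ 2 := by gcongr; linarith
  have ha2 : a ^ 2 ≤ (0.7071098 : ℝ) ^ 2 := by
    have : 0 ≤ a := by linarith
    gcongr; linarith
  have hi0 : 0 ≤ z.im ^ 2 := sq_nonneg _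
  have hN1 : 0.49999 ≤ N := by rw [hNz]; linarith
  have hN2 : N ≤ 0.500005 := by rw [hNz]; linarith
  have hN0 : 0 < N := by linarith
  obtain ⟨f, hf, h⟩ := exists_seriesB_zero (r := a / N) (q := 1 / N)
    (by
      rw [abs_le]
      constructor
      · rw [le_sub_iff_add_le, le_div_iff₀ hN0, hNz]; nlinarith
      · rw [sub_le_iff_le_add, div_le_iff₀ hN0, hNz]; nlinarith)
    (by
      rw [abs_le]
      constructor
      · rw [le_sub_iff_add_le, le_div_iff₀ hN0]; linarith
      · rw [sub_le_iff_le_add, div_le_iff₀ hN0]; linarith)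
    (by
      have : (a / N) ^ 2 - 1 / N = -(z.im ^ 2 / N ^ 2) := by
        field_simp
        rw [hNz]
        ring
      rw [this, abs_neg, abs_of_nonneg (by positivity), div_le_iff₀ (by positivity)]
      nlinarith) ℂ
  refine ⟨hnorm, f, hf, h z hnorm ?_⟩
  have hNc : (N : ℂ) ≠ 0 := by exact_mod_cast hN0.ne'
  have hquad : (N : ℂ) - 2 * a * z + z ^ 2 = 0 := by
    apply Complex.ext
    · simp [hNz, ← ha, sq]
      ring
    · simp [← ha, sq]
      ring
  change (1 : ℂ) - 2 * ((a / N : ℝ) : ℂ) * z + ((1 / N : ℝ) : ℂ) * z ^ 2 = 0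
  push_cast
  field_simp
  linear_combination hquad

theorem mem_Omega2_of_near {x : ℝ} (hx : |x - invSqrtTwo| < 4 / 10 ^ 6) : x ∈ Omega2 := by
  obtain ⟨h0, h1, hx1, hx2⟩ := inv_bounds_of_near hx
  refine ⟨⟨h0, h1⟩, exists_seriesB_double_zero h0 h1 ?_ ?_⟩
  · rw [abs_le]; constructor <;> linarith
  · rw [abs_le]; constructor <;> nlinarith

theorem Omega2_subset_locusO : Omega2 ⊆ locusO := fun _ ⟨⟨h0, h1⟩, h⟩ => ⟨⟨by linarith, h1⟩, h⟩

/-- A tail of size at most `1/3` cannot cancel the constant term `1`. This nonemptiness makes the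
supremum a genuine least upper bound. -/
theorem quarter_not_mem_Omega2 : (1 / 4 : ℝ) ∉ Omega2 := by
  rintro ⟨-, f, hf, h, -⟩
  have hs := summable_of_mem_seriesB (𝕜 := ℝ) hf (z := 1 / 4) (by norm_num)
  rw [seriesFun, hs.tsum_eq_zero_add, hf.1] at h
  have hgeo : HasSum (fun n : ℕ => (1 / 4 : ℝ) * (1 / 4) ^ n) ((1 / 4) * (1 - 1 / 4)⁻¹) :=
    (hasSum_geometric_of_lt_one (by norm_num) (by norm_num)).mul_left _
  have hb : ‖∑' n : ℕ, ((PowerSeries.coeff (n + 1) f : ℤ) : ℝ) * (1 / 4) ^ (n + 1)‖ ≤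
      (1 / 4) * (1 - 1 / 4)⁻¹ := by
    refine tsum_of_norm_bounded hgeo fun n => ?_
    rw [norm_mul, Real.norm_eq_abs, Real.norm_of_nonneg (by positivity), pow_succ']
    exact mul_le_of_le_one_left (by positivity) (coeff_abs_le_one_of_mem_seriesB hf _)
  rw [Real.norm_eq_abs, abs_le] at hb
  norm_num at h hb
  linarith

theorem mem_Omega2_of_gt {x : ℝ} (hx : invSqrtTwo - 4 / 10 ^ 6 < x) (h1 : x < 1) :
    x ∈ Omega2 := by
  have hc := invSqrtTwo_pos
  rcases lt_or_ge x (invSqrtTwo + 4 / 10 ^ 6) with h | h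
  · exact mem_Omega2_of_near (abs_lt.2 ⟨by linarith, by linarith⟩)
  · refine mem_Omega2_of_half_lt_sq (by linarith) h1 ?_
    rw [← invSqrtTwo_sq]
    exact pow_lt_pow_left₀ (by linarith) hc.le two_ne_zero

theorem interior_locusN_diff_nonempty : (interior (locusN \ trivialN)).Nonempty := by
  obtain ⟨h1, h2⟩ := invSqrtTwo_bounds
  -- The interval lies to the left of `2^{-1/2}`, so products of its points stay below `1/2`.
  let I := Ioo (invSqrtTwo - 4 / 10 ^ 6) invSqrtTwo
  refine ⟨(invSqrtTwo - 2 / 10 ^ 6, invSqrtTwo - 2 / 10 ^ 6),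
    mem_interior.2 ⟨I ×ˢ I, ?_, isOpen_Ioo.prod isOpen_Ioo, ?_⟩⟩
  · rintro ⟨g, l⟩ ⟨⟨hg1, hg2⟩, hl1, hl2⟩
    dsimp only at hg1 hg2 hl1 hl2
    refine ⟨mem_locusN_of_near (abs_lt.2 ⟨by linarith, by linarith⟩)
      (abs_lt.2 ⟨by linarith, by linarith⟩), fun h => ?_⟩
    have h' : 1 / 2 ≤ |g * l| := h.2.2
    have hg0 : 0 < g := by linarith
    have hl0 : 0 < l := by linarith
    rw [abs_of_pos (mul_pos hg0 hl0), ← invSqrtTwo_sq, sq] at h'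
    exact absurd h' (not_le.2 (mul_lt_mul'' hg2 hl2 hg0.le hl0.le))
  · constructor <;> constructor <;> dsimp only <;> linarith

theorem interior_locusM_diff_nonempty : (interior (locusM \ trivialM)).Nonempty := by
  obtain ⟨h1, h2⟩ := invSqrtTwo_bounds
  refine ⟨((invSqrtTwo - 1 / 10 ^ 6 : ℝ) : ℂ), mem_interior.2
    ⟨Metric.ball (invSqrtTwo : ℂ) (3 / 10 ^ 6) ∩ Metric.ball 0 invSqrtTwo, ?_,
      Metric.isOpen_ball.inter Metric.isOpen_ball, ?_, ?_⟩⟩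
  · rintro z ⟨hz1, hz2⟩
    rw [mem_ball_iff_norm] at hz1 hz2
    rw [sub_zero] at hz2
    exact ⟨mem_locusM_of_near hz1, fun h => not_lt.2 h.2 hz2⟩
  · rw [mem_ball_iff_norm, ← Complex.ofReal_sub, Complex.norm_real, Real.norm_eq_abs, abs_lt]
    constructor <;> linarith
  · rw [mem_ball_iff_norm, sub_zero, Complex.norm_real, Real.norm_eq_abs, abs_lt]
    constructor <;> linarith

theorem interior_locusO_diff_nonempty : (interior (locusO \ trivialO)).Nonempty := by
  obtain ⟨h1, h2⟩ := invSqrtTwo_bounds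
  refine ⟨invSqrtTwo - 2 / 10 ^ 6, mem_interior.2
    ⟨Ioo (invSqrtTwo - 4 / 10 ^ 6) invSqrtTwo, ?_, isOpen_Ioo, by linarith, by linarith⟩⟩
  rintro x ⟨hx1, hx2⟩
  refine ⟨Omega2_subset_locusO (mem_Omega2_of_near (abs_lt.2 ⟨by linarith, by linarith⟩)),
    fun h => ?_⟩
  have := h.2
  rw [abs_of_pos (by linarith)] at this
  linarith

theorem theorem2p8 (η : ℝ) (hη : η = 4 / 10 ^ 6) :
    {p : ℝ × ℝ | p.1 ∈ Ioo (0 : ℝ) 1 ∧ p.2 ∈ Ioo (0 : ℝ) 1 ∧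
        |p.1 - invSqrtTwo| < η ∧ |p.2 - invSqrtTwo| < η} ⊆ locusN ∧
    {z : ℂ | ‖z‖ < 1 ∧ ‖z - (invSqrtTwo : ℂ)‖ < 3 * η / 4} ⊆ locusM ∧
    {x : ℝ | x ∈ Ioo (0 : ℝ) 1 ∧ |x - invSqrtTwo| < η} ⊆ locusO ∧
    {x : ℝ | x ∈ Ioo (0 : ℝ) 1 ∧ |x - invSqrtTwo| < η} ⊆ Omega2 ∧
    (interior (locusN \ trivialN)).Nonempty ∧
    (interior (locusM \ trivialM)).Nonempty ∧
    (interior (locusO \ trivialO)).Nonempty ∧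
    IsLUB (Ioo (0 : ℝ) 1 \ Omega2) (sSup (Ioo (0 : ℝ) 1 \ Omega2)) ∧
    sSup (Ioo (0 : ℝ) 1 \ Omega2) ≤ invSqrtTwo - 4 / 10 ^ 6 := by
  subst hη
  have hne : (Ioo (0 : ℝ) 1 \ Omega2).Nonempty :=
    ⟨1 / 4, ⟨by norm_num, by norm_num⟩, quarter_not_mem_Omega2⟩
  have hub : ∀ x ∈ Ioo (0 : ℝ) 1 \ Omega2, x ≤ invSqrtTwo - 4 / 10 ^ 6 := fun x hx =>
    not_lt.1 fun h => hx.2 (mem_Omega2_of_gt h hx.1.2)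
  refine ⟨fun p hp => mem_locusN_of_near hp.2.2.1 hp.2.2.2, fun z hz => mem_locusM_of_near ?_,
    fun x hx => Omega2_subset_locusO (mem_Omega2_of_near hx.2), fun x hx => mem_Omega2_of_near hx.2,
    interior_locusN_diff_nonempty, interior_locusM_diff_nonempty, interior_locusO_diff_nonempty,
    isLUB_csSup hne ⟨_, hub⟩, csSup_le hne hub⟩
  have := hz.2
  norm_num at this ⊢
  exact this
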